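/- Let $\lambda>0$ and let $f:[0,\infty)\to\mathbb R$ be piecewise differentiable, i.e. continuous on $[0,\infty)$ and differentiable at all but finitely many points of each bounded interval $(0,T)$, with $f(0)=0$ (at the exceptional points, a null set, put $f':=0$). For $X\sim\mathrm{Exp}(\lambda)$ (density $\lambda e^{-\lambda x}$ on $(0,\infty)$) put $\mu_f(k,l,m):=\mathbb E\big[X^k f(X)^l f'(X)^m\big]$, and assume that $\mathbb E[f(X)^2]<\infty$ and $\mathbb E[f'(X)^2]<\infty$. Let $X_1,X_2,\dots$ be i.i.d. $\mathrm{Exp}(\lambda)$, let $Z_i:=(f'(X_i),f(X_i))^\top$, $\overline Z_n:=\frac1n\sum_{i=1}^n Z_i$, $\mu_Z:=\mathbb E[Z_1]$, and let $\Sigma=(\sigma_{ij})_{i,j=1,2}$ be the covariance matrix of $Z_1$. Then $\mu_Z=\mu_f(0,1,0)\,(\lambda,1)^\top$, and, as $n\to\infty$, $$\sqrt n\,\big(\overline Z_n-\mu_Z\big)\ \xrightarrow{d}\ \mathrm N(0,\Sigma),$$ where $\Sigma$ is symmetric positive semidefinite with $$\sigma_{11}=\mu_f(0,0,2)-\lambda^2\mu_f(0,1,0)^2,\qquad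 \sigma_{22}=\mu_f(0,2,0)-\mu_f(0,1,0)^2,$$ $$\sigma_{12}=\sigma_{21}=\tfrac{\lambda}{2}\big(\sigma_{22}-\mu_f(0,1,0)^2\big)=\lambda\big(\sigma_{22}-\tfrac12\mu_f(0,2,0)\big).$$ -/

import Mathlib

open MeasureTheory ProbabilityTheory Filter

/-- A function on `[0, ∞)` is piecewise differentiable if it is continuous on `[0, ∞)` and, in every
bounded interval `(0, T)`, differentiable at all but finitely many points. No differentiability is
required at `0`, and the values of `f` on `(-∞, 0)` play no role. -/
structure IsPiecewiseDifferentiable (f : ℝ → ℝ) : Prop where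
  continuousOn : ContinuousOn f (Set.Ici 0)
  finite_not_differentiableAt :
    ∀ T : ℝ, {x : ℝ | x ∈ Set.Ioo 0 T ∧ ¬ DifferentiableAt ℝ f x}.Finite

/-- The joint moment `μ_f(k, l, m) = E[X ^ k * f(X) ^ l * f'(X) ^ m]` for `X ∼ Exp(lam)`. -/
noncomputable def expMoment (lam : ℝ) (f : ℝ → ℝ) (k l m : ℕ) : ℝ :=
  ∫ x, x ^ k * f x ^ l * deriv f x ^ m ∂(expMeasure lam)

/-- The vector `(f'(x), f(x))`, so that `Z_i = steinVec f (X_i)`. -/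
noncomputable def steinVec (f : ℝ → ℝ) (x : ℝ) : EuclideanSpace ℝ (Fin 2) :=
  !₂[deriv f x, f x]

/-- The mean vector `μ_Z = (E[f'(X)], E[f(X)])` for `X ∼ Exp(lam)`. -/
noncomputable def steinMean (lam : ℝ) (f : ℝ → ℝ) : EuclideanSpace ℝ (Fin 2) :=
  !₂[∫ x, deriv f x ∂(expMeasure lam), ∫ x, f x ∂(expMeasure lam)]

/-- The covariance matrix `Σ` of `Z = (f'(X), f(X))` for `X ∼ Exp(lam)`. -/
noncomputable def steinCov (lam : ℝ) (f : ℝ → ℝ) : Matrix (Fin 2) (Fin 2) ℝ :=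
  Matrix.of fun i j => cov[fun x => steinVec f x i, fun x => steinVec f x j; expMeasure lam]

/-- The sample mean `(Z_1 + ⋯ + Z_n) / n`, where `Z_1, …, Z_n` are built from the first `n`
members of the sequence `X`. -/
noncomputable def steinSampleMean {Ω : Type*} (f : ℝ → ℝ) (X : ℕ → Ω → ℝ) (n : ℕ) (ω : Ω) :
    EuclideanSpace ℝ (Fin 2) :=
  (n : ℝ)⁻¹ • ∑ i ∈ Finset.range n, steinVec f (X i ω)

/-! ### Multivariate central limit theorem -/

section Multivariate

variable {Ω ι : Type*} [MeasurableSpace Ω] [Fintype ι] {P : Measure Ω}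

/-! Cramér–Wold reduces convergence to the scalar CLT for each ⟨Z, t⟩, whose variance is tᵀΣt. The
explicit Σ comes from the Stein identity E[g'(X)] = λ E[g(X)] for g(0) = 0, an integration by parts
against e^{-λx}: g = f gives the mean, and g = f² gives E[f f'] = (λ/2) E[f²], hence σ₁₂. -/

theorem memLp_euclideanSpace_apply {Z : Ω → EuclideanSpace ℝ ι} {p : ENNReal} (hZ : MemLp Z p P)
    (i : ι) : MemLp (fun ω => Z ω i) p P :=
  ((EuclideanSpace.proj i : EuclideanSpace ℝ ι →L[ℝ] ℝ)).comp_memLp' hZ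

/-- The variance of a linear form of a square integrable random vector is the quadratic form of its
covariance matrix. -/
theorem variance_inner_eq_dotProduct_mulVec [IsProbabilityMeasure P]
    {Z : Ω → EuclideanSpace ℝ ι} (hZ : MemLp Z 2 P)
    {S : Matrix ι ι ℝ} (hS : ∀ i j, S i j = cov[fun ω => Z ω i, fun ω => Z ω j; P])
    (t : EuclideanSpace ℝ ι) :
    Var[fun ω => inner ℝ (Z ω) t; P] = t ⬝ᵥ S.mulVec t := by
  have hc i : MemLp (fun ω => t i * Z ω i) 2 P := (memLp_euclideanSpace_apply hZ i).const_mul _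
  have h : (fun ω => inner ℝ (Z ω) t) = fun ω => ∑ i, t i * Z ω i := by
    ext ω; simp [PiLp.inner_apply]
  rw [h, ← covariance_self (memLp_finsetSum _ fun i _ => hc i).aemeasurable,
    covariance_fun_sum_fun_sum hc hc]
  simp only [covariance_const_mul_left, covariance_const_mul_right, ← hS, dotProduct,
    Matrix.mulVec, Finset.mul_sum]
  exact Finset.sum_congr rfl fun i _ => Finset.sum_congr rfl fun j _ => by ring

theorem posSemidef_of_eq_covariance [IsProbabilityMeasure P]
    {Z : Ω → EuclideanSpace ℝ ι} (hZ : MemLp Z 2 P)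
    {S : Matrix ι ι ℝ} (hS : ∀ i j, S i j = cov[fun ω => Z ω i, fun ω => Z ω j; P]) :
    S.PosSemidef := by
  refine Matrix.PosSemidef.of_dotProduct_mulVec_nonneg ?_ fun x => ?_
  · ext i j
    simp [hS, covariance_comm]
  · have := variance_inner_eq_dotProduct_mulVec hZ hS (WithLp.toLp 2 x)
    simp [← this, variance_nonneg]

/-- The Cramér–Wold device: both sides are E[exp(i⟨X, t⟩)]. -/
theorem charFun_map_eq_charFun_map_inner {X : Ω → EuclideanSpace ℝ ι} (hX : AEMeasurable X P)
    (t : EuclideanSpace ℝ ι) :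
    charFun (P.map X) t = charFun (P.map fun ω => inner ℝ (X ω) t) 1 := by
  rw [charFun_apply, charFun_apply, integral_map hX (by fun_prop),
    integral_map (by fun_prop) (by fun_prop)]
  simp

/-- **Multivariate central limit theorem** for independent identically distributed square
integrable random vectors. -/
theorem tendstoInDistribution_sqrt_smul_sampleMean_sub [DecidableEq ι] [IsProbabilityMeasure P]
    {Z : ℕ → Ω → EuclideanSpace ℝ ι}
    (hindep : iIndepFun Z P) (hident : ∀ i, IdentDistrib (Z i) (Z 0) P P) (hZ : MemLp (Z 0) 2 P)
    {m : EuclideanSpace ℝ ι} (hm : ∀ i, m i = ∫ ω, Z 0 ω i ∂P)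
    {S : Matrix ι ι ℝ} (hS : ∀ i j, S i j = cov[fun ω => Z 0 ω i, fun ω => Z 0 ω j; P]) :
    TendstoInDistribution
      (fun (n : ℕ) (ω : Ω) => √(n : ℝ) • ((n : ℝ)⁻¹ • ∑ i ∈ Finset.range n, Z i ω - m))
      atTop id (fun _ => P) (multivariateGaussian 0 S) where
  forall_aemeasurable n := by
    have := fun i => (hident i).aemeasurable_fst
    have := Finset.aemeasurable_fun_sum (Finset.range n) fun i _ => this i
    fun_prop
  tendsto := by
    have hae := fun i => (hident i).aemeasurable_fst
    refine ProbabilityMeasure.tendsto_iff_tendsto_charFun.2 fun t => ?_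
    have hmeas : Measurable fun z : EuclideanSpace ℝ ι => inner ℝ z t := by fun_prop
    have hvar := variance_inner_eq_dotProduct_mulVec hZ hS t
    have hL2 : MemLp (fun ω => inner ℝ (Z 0 ω) t) 2 P := hZ.inner_const t
    have hmean : ∫ ω, inner ℝ (Z 0 ω) t ∂P = inner ℝ m t := by
      simp only [PiLp.inner_apply]
      rw [integral_finsetSum]
      · simp [hm, integral_const_mul]
      · intro i _
        simpa using ((memLp_euclideanSpace_apply hZ i).integrable one_le_two).const_mul (t i)
    have clt := tendstoInDistribution_inv_sqrt_mul_sum_sub (P := P)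
      (P' := gaussianReal 0 Var[fun ω => inner ℝ (Z 0 ω) t; P].toNNReal) (Y := id)
      (X := fun i ω => inner ℝ (Z i ω) t) ⟨aemeasurable_id, Measure.map_id⟩ hL2
      (hindep.comp (fun _ z => inner ℝ z t) fun _ => hmeas)
      fun i => (hident i).comp hmeas
    have key := ProbabilityMeasure.tendsto_iff_tendsto_charFun.1 clt.tendsto 1
    simp only [ProbabilityMeasure.coe_mk, Measure.map_id] at key ⊢
    rw [charFun_multivariateGaussian (posSemidef_of_eq_covariance hZ hS), ← hvar]
    rw [charFun_gaussianReal, Real.coe_toNNReal _ (variance_nonneg _ _)] at key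
    convert key using 2 with n
    · have hsum := Finset.aemeasurable_fun_sum (Finset.range n) fun i _ => hae i
      rw [charFun_map_eq_charFun_map_inner (by fun_prop)]
      congr 2
      ext ω
      rw [hmean, inner_smul_left, inner_sub_left, inner_smul_left, sum_inner]
      -- For n = 0 both sides vanish, since √0 = 0. Otherwise √n (S/n - m) = (S - n m)/√n.
      rcases eq_or_ne n 0 with rfl | hn
      · simp
      · have : √(n : ℝ) ≠ 0 := by positivity
        have h2 : √(n : ℝ) ^ 2 = n := Real.sq_sqrt (Nat.cast_nonneg n)
        simp only [conj_trivial]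
        field_simp
        rw [h2]
    · simp

end Multivariate

/-! ### Stein identity for the exponential law -/

section Exponential

variable {lam : ℝ}

/-- The point 0 is null, so the open half-line suffices and differentiability at 0 never matters. -/
theorem expMeasure_eq_withDensity_restrict (lam : ℝ) :
    expMeasure lam = (volume.restrict (Set.Ioi 0)).withDensity
      fun x => ENNReal.ofReal (lam * Real.exp (-(lam * x))) := by
  have hd : Measurable fun x : ℝ => ENNReal.ofReal (lam * Real.exp (-(lam * x))) := by fun_prop
  rw [Measure.restrict_congr_set Ioi_ae_eq_Ici, ← withDensity_indicator measurableSet_Ici]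
  change volume.withDensity (exponentialPDF lam) = _
  congr 1
  ext x
  by_cases hx : 0 ≤ x <;> simp [exponentialPDF_eq, Set.indicator, hx]

theorem expMeasure_absolutelyContinuous (lam : ℝ) :
    expMeasure lam ≪ volume.restrict (Set.Ioi 0) := by
  rw [expMeasure_eq_withDensity_restrict]
  exact withDensity_absolutelyContinuous _ _

theorem integral_expMeasure (hlam : 0 < lam) (g : ℝ → ℝ) :
    ∫ x, g x ∂(expMeasure lam) = lam * ∫ x in Set.Ioi 0, Real.exp (-(lam * x)) * g x := by
  rw [expMeasure_eq_withDensity_restrict, integral_withDensity_eq_integral_toReal_smul (by fun_prop)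
    (by simp), ← integral_const_mul]
  congr 1
  ext x
  rw [ENNReal.toReal_ofReal (by positivity), smul_eq_mul, mul_assoc]

theorem integrable_expMeasure_iff (hlam : 0 < lam) (g : ℝ → ℝ) :
    Integrable g (expMeasure lam) ↔
      IntegrableOn (fun x => Real.exp (-(lam * x)) * g x) (Set.Ioi 0) := by
  rw [expMeasure_eq_withDensity_restrict, integrable_withDensity_iff_integrable_smul' (by fun_prop)
    (by simp), IntegrableOn, ← integrable_const_mul_iff (isUnit_iff_ne_zero.2 hlam.ne')
      (fun x => Real.exp (-(lam * x)) * g x)]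
  refine iff_of_eq (congrArg (fun F => Integrable F _) ?_)
  ext x
  rw [ENNReal.toReal_ofReal (by positivity), smul_eq_mul, mul_assoc]

/-- If `h` is continuous on `[0, ∞)`, has derivative `h'` on `(0, ∞)` off a countable set, and `h` and
`h'` are integrable on `(0, ∞)`, then the integral of `h'` over `(0, ∞)` is `-h 0`. -/
theorem integral_Ioi_of_hasDerivAt_off_countable {h h' : ℝ → ℝ} {s : Set ℝ} (hs : s.Countable)
    (hcont : ContinuousOn h (Set.Ici 0)) (hderiv : ∀ x ∈ Set.Ioi 0 \ s, HasDerivAt h (h' x) x)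
    (hint : IntegrableOn h (Set.Ioi 0)) (hint' : IntegrableOn h' (Set.Ioi 0)) :
    ∫ x in Set.Ioi 0, h' x = -h 0 := by
  have ht := intervalIntegral_tendsto_integral_Ioi 0 hint' tendsto_id
  have hev : ∀ᶠ T : ℝ in atTop, ∫ x in (0 : ℝ)..id T, h' x = h T - h 0 := by
    filter_upwards [eventually_ge_atTop 0] with T hT
    refine integral_eq_of_hasDerivAt_off_countable_of_le h h' hT hs
      (hcont.mono Set.Icc_subset_Ici_self) (fun x hx => hderiv x ⟨hx.1.1, hx.2⟩) ?_
    exact (intervalIntegrable_iff_integrableOn_Ioc_of_le hT).2 <| hint'.mono_set Set.Ioc_subset_Ioi_self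
  -- Integrability of `h'` makes `h` converge at infinity. A nonzero limit would contradict
  -- integrability of `h`, as every neighbourhood of infinity has infinite measure.
  have hlim : Tendsto h atTop (nhds ((∫ x in Set.Ioi 0, h' x) + h 0)) := by
    refine ((ht.congr' hev).add_const (h 0)).congr fun T => by ring
  have := IntegrableAtFilter.eq_zero_of_tendsto (μ := volume)
    ⟨Set.Ioi 0, Ioi_mem_atTop _, hint⟩ (fun s hs => ?_) hlim
  · linarith
  · obtain ⟨b, hb⟩ := mem_atTop_sets.1 hs
    rw [← top_le_iff, ← Real.volume_Ici (a := b)]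
    exact measure_mono hb

/-- **Stein identity** for the exponential distribution. -/
theorem integral_expMeasure_deriv_eq (hlam : 0 < lam) {g g' : ℝ → ℝ} {s : Set ℝ} (hs : s.Countable)
    (hcont : ContinuousOn g (Set.Ici 0)) (hderiv : ∀ x ∈ Set.Ioi 0 \ s, HasDerivAt g (g' x) x)
    (hg0 : g 0 = 0) (hg : Integrable g (expMeasure lam)) (hg' : Integrable g' (expMeasure lam)) :
    ∫ x, g' x ∂(expMeasure lam) = lam * ∫ x, g x ∂(expMeasure lam) := by
  rw [integrable_expMeasure_iff hlam] at hg hg'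
  -- The boundary term is -g(0) = 0, so the integral of (e^{-λx} g)' = e^{-λx} (g' - λg) vanishes.
  have key := integral_Ioi_of_hasDerivAt_off_countable (h := fun x => Real.exp (-(lam * x)) * g x)
    (h' := fun x => Real.exp (-(lam * x)) * g' x - lam * (Real.exp (-(lam * x)) * g x)) hs
    (by fun_prop) (fun x hx => ?_) hg (hg'.sub (hg.const_mul lam))
  · rw [integral_sub hg' (hg.const_mul lam), integral_const_mul] at key
    simp only [hg0, mul_zero, neg_zero] at key
    rw [integral_expMeasure hlam, integral_expMeasure hlam, sub_eq_zero.1 key]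
  · have he : HasDerivAt (fun y => Real.exp (-(lam * y))) (Real.exp (-(lam * x)) * -lam) x := by
      simpa using (((hasDerivAt_id x).const_mul lam).neg).exp
    convert! he.mul (hderiv x hx) using 1
    ring

end Exponential

/-! ### Moments of piecewise differentiable functions -/

namespace IsPiecewiseDifferentiable

variable {f : ℝ → ℝ} {lam : ℝ}

/-- Kinks may accumulate only at infinity; a countable exceptional set is all that the fundamental
theorem of calculus used here needs. -/
theorem countable_not_differentiableAt (hf : IsPiecewiseDifferentiable f) :
    {x : ℝ | 0 < x ∧ ¬ DifferentiableAt ℝ f x}.Countable := by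
  refine (Set.countable_iUnion fun n : ℕ =>
    (hf.finite_not_differentiableAt n).countable).mono fun x hx => ?_
  obtain ⟨n, hn⟩ := exists_nat_gt x
  exact Set.mem_iUnion.2 ⟨n, ⟨hx.1, hn⟩, hx.2⟩

theorem hasDerivAt (f : ℝ → ℝ) {x : ℝ}
    (hx : x ∈ Set.Ioi 0 \ {x : ℝ | 0 < x ∧ ¬ DifferentiableAt ℝ f x}) :
    HasDerivAt f (deriv f x) x := by
  by_contra h
  exact hx.2 ⟨hx.1, fun h' => h h'.hasDerivAt⟩

theorem aemeasurable (hf : IsPiecewiseDifferentiable f) : AEMeasurable f (expMeasure lam) :=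
  ((hf.continuousOn.mono Set.Ioi_subset_Ici_self).aemeasurable measurableSet_Ioi).mono_ac
    (expMeasure_absolutelyContinuous lam)

theorem aemeasurable_deriv (hf : IsPiecewiseDifferentiable f) :
    AEMeasurable (deriv f) (expMeasure lam) := by
  have hext : Continuous fun x => f (max x 0) :=
    hf.continuousOn.comp_continuous (by fun_prop) fun x => le_max_right x 0
  refine AEMeasurable.mono_ac ?_ (expMeasure_absolutelyContinuous lam)
  refine (measurable_deriv fun x => f (max x 0)).aemeasurable.congr ?_
  filter_upwards [ae_restrict_mem measurableSet_Ioi] with x hx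
  refine EventuallyEq.deriv_eq ?_
  filter_upwards [Ioi_mem_nhds hx] with y hy
  rw [max_eq_left (le_of_lt hy)]

theorem memLp_two (hf : IsPiecewiseDifferentiable f)
    (hf_sq : Integrable (fun x => f x ^ 2) (expMeasure lam)) : MemLp f 2 (expMeasure lam) :=
  (memLp_two_iff_integrable_sq hf.aemeasurable.aestronglyMeasurable).2 hf_sq

theorem memLp_two_deriv (hf : IsPiecewiseDifferentiable f)
    (hf'_sq : Integrable (fun x => deriv f x ^ 2) (expMeasure lam)) :
    MemLp (deriv f) 2 (expMeasure lam) :=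
  (memLp_two_iff_integrable_sq hf.aemeasurable_deriv.aestronglyMeasurable).2 hf'_sq

theorem integral_deriv (hlam : 0 < lam) (hf : IsPiecewiseDifferentiable f) (hf0 : f 0 = 0)
    (h2 : MemLp f 2 (expMeasure lam)) (h2' : MemLp (deriv f) 2 (expMeasure lam)) :
    ∫ x, deriv f x ∂(expMeasure lam) = lam * ∫ x, f x ∂(expMeasure lam) := by
  have := isProbabilityMeasure_expMeasure hlam
  exact integral_expMeasure_deriv_eq hlam hf.countable_not_differentiableAt hf.continuousOn
    (fun x hx => hasDerivAt f hx) hf0 (h2.integrable one_le_two) (h2'.integrable one_le_two)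

/-- Stein identity for f², with (f²)' = 2 f f'. Square integrability of f and f' makes f f'
integrable. -/
theorem integral_deriv_mul (hlam : 0 < lam) (hf : IsPiecewiseDifferentiable f) (hf0 : f 0 = 0)
    (h2 : MemLp f 2 (expMeasure lam)) (h2' : MemLp (deriv f) 2 (expMeasure lam)) :
    ∫ x, deriv f x * f x ∂(expMeasure lam) = lam / 2 * ∫ x, f x ^ 2 ∂(expMeasure lam) := by
  have h := integral_expMeasure_deriv_eq hlam (g := fun x => f x ^ 2)
    (g' := fun x => 2 * (deriv f x * f x)) hf.countable_not_differentiableAt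
    (hf.continuousOn.pow 2) (fun x hx => ?_) (by simp [hf0]) h2.integrable_sq
    ((h2'.integrable_mul h2).const_mul 2)
  · rw [integral_const_mul] at h
    linarith
  · convert! (hasDerivAt f hx).pow 2 using 1
    simp
    ring

end IsPiecewiseDifferentiable

theorem memLp_two_steinVec {μ : Measure ℝ} {f : ℝ → ℝ} (h2 : MemLp f 2 μ)
    (h2' : MemLp (deriv f) 2 μ) : MemLp (steinVec f) 2 μ := by
  refine MemLp.of_eval_piLp fun i => ?_
  fin_cases i
  · exact h2'
  · exact h2

theorem mainTheorem7 {Ω : Type*} [MeasurableSpace Ω] (P : Measure Ω) [IsProbabilityMeasure P]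
    (lam : ℝ) (hlam : 0 < lam)
    (X : ℕ → Ω → ℝ) (hindep : iIndepFun X P) (hlaw : ∀ i, HasLaw (X i) (expMeasure lam) P)
    (f : ℝ → ℝ) (hf : IsPiecewiseDifferentiable f) (hf0 : f 0 = 0)
    (hf_sq : Integrable (fun x => f x ^ 2) (expMeasure lam))
    (hf'_sq : Integrable (fun x => deriv f x ^ 2) (expMeasure lam)) :
    steinMean lam f = expMoment lam f 0 1 0 • !₂[lam, 1] ∧
    (steinCov lam f).PosSemidef ∧
    TendstoInDistribution
      (fun (n : ℕ) (ω : Ω) => √(n : ℝ) • (steinSampleMean f X n ω - steinMean lam f))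
      atTop id (fun _ => P) (multivariateGaussian 0 (steinCov lam f)) ∧
    steinCov lam f 0 0 = expMoment lam f 0 0 2 - lam ^ 2 * expMoment lam f 0 1 0 ^ 2 ∧
    steinCov lam f 1 1 = expMoment lam f 0 2 0 - expMoment lam f 0 1 0 ^ 2 ∧
    steinCov lam f 1 0 = steinCov lam f 0 1 ∧
    steinCov lam f 0 1 = lam / 2 * (steinCov lam f 1 1 - expMoment lam f 0 1 0 ^ 2) ∧
    steinCov lam f 0 1 = lam * (steinCov lam f 1 1 - 1 / 2 * expMoment lam f 0 2 0) := by
  have := isProbabilityMeasure_expMeasure hlam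
  have h2 := hf.memLp_two hf_sq
  have h2' := hf.memLp_two_deriv hf'_sq
  have hmean := hf.integral_deriv hlam hf0 h2 h2'
  have hcross := hf.integral_deriv_mul hlam hf0 h2 h2'
  have hvec := memLp_two_steinVec h2 h2'
  have e010 : expMoment lam f 0 1 0 = ∫ x, f x ∂(expMeasure lam) := by simp [expMoment]
  have e020 : expMoment lam f 0 2 0 = ∫ x, f x ^ 2 ∂(expMeasure lam) := by simp [expMoment]
  have e002 : expMoment lam f 0 0 2 = ∫ x, deriv f x ^ 2 ∂(expMeasure lam) := by simp [expMoment]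
  have c00 : steinCov lam f 0 0 =
      expMoment lam f 0 0 2 - lam ^ 2 * expMoment lam f 0 1 0 ^ 2 := by
    change cov[deriv f, deriv f; expMeasure lam] = _
    rw [covariance_eq_sub h2' h2', hmean, e010, e002]
    simp only [Pi.mul_apply, ← pow_two, mul_pow]
  have c11 : steinCov lam f 1 1 = expMoment lam f 0 2 0 - expMoment lam f 0 1 0 ^ 2 := by
    change cov[f, f; expMeasure lam] = _
    rw [covariance_eq_sub h2 h2, e010, e020]
    simp only [Pi.mul_apply, ← pow_two]
  have c01 : steinCov lam f 0 1 =
      lam / 2 * expMoment lam f 0 2 0 - lam * expMoment lam f 0 1 0 ^ 2 := by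
    change cov[deriv f, f; expMeasure lam] = _
    rw [covariance_eq_sub h2' h2, hmean, e010, e020, ← hcross]
    simp only [Pi.mul_apply]
    ring
  have hS : ∀ i j, steinCov lam f i j =
      cov[fun x => steinVec f x i, fun x => steinVec f x j; expMeasure lam] := fun _ _ => rfl
  -- As f is arbitrary on (-∞, 0), `steinVec f` is only known to be a.e. measurable for the law of
  -- `X i`.
  have hae : ∀ i, AEMeasurable (steinVec f) (P.map (X i)) := fun i => by
    rw [(hlaw i).map_eq]; exact hvec.aestronglyMeasurable.aemeasurable
  have hcoord : ∀ i, AEStronglyMeasurable (fun x => steinVec f x i) (P.map (X 0)) := fun i => by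
    rw [(hlaw 0).map_eq]; exact (memLp_euclideanSpace_apply hvec i).aestronglyMeasurable
  refine ⟨?_, posSemidef_of_eq_covariance hvec hS, ?_, c00, c11, ?_, ?_, ?_⟩
  · ext i
    fin_cases i
    · simp [steinMean, e010, hmean, mul_comm]
    · simp [steinMean, e010]
  · refine tendstoInDistribution_sqrt_smul_sampleMean_sub (Z := fun i ω => steinVec f (X i ω))
      (hindep.comp₀ (fun _ => steinVec f) (fun i => (hlaw i).aemeasurable) hae)
      (fun i => ?_) ?_ (fun i => ?_) (fun i j => ?_)
    · have hid : IdentDistrib (X i) (X 0) P P :=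
        ⟨(hlaw i).aemeasurable, (hlaw 0).aemeasurable, (hlaw i).map_eq.trans (hlaw 0).map_eq.symm⟩
      exact hid.comp_of_aemeasurable (hae i)
    · exact MemLp.comp_of_map (g := steinVec f) ((hlaw 0).map_eq ▸ hvec) (hlaw 0).aemeasurable
    · rw [← integral_map (hlaw 0).aemeasurable (hcoord i), (hlaw 0).map_eq]
      fin_cases i <;> rfl
    · rw [hS, ← (hlaw 0).map_eq, covariance_map_fun (hcoord i) (hcoord j) (hlaw 0).aemeasurable]
  · exact covariance_comm _ _
  · rw [c01, c11]; ring
  · rw [c01, c11]; ring
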